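/- Let $K$ be a number field with ring of integers $R$ and let $L/K$ be a quadratic field extension. Let $J$ be a full $R$-lattice in $L$, i.e. an $R$-submodule $J\subseteq L$ such that $J\subseteq Rx_1+Rx_2$ for some $K$-basis $x_1,x_2$ of $L$ and such that $J$ spans $L$ over $K$ (equivalently, $J\otimes_R K=L$). Let $x_0\in L\setminus K$ be arbitrary and put $$\mathfrak a=\{k\in K : kx_0\in J+K\}.$$ Then $J\cong R\oplus \mathfrak a\cdot(J\cap K)$ as $R$-modules, and $J$ is free as an $R$-module if and only if $\mathfrak a\cdot(J\cap K)$ is a principal fractional ideal of $R$, i.e. equal to $Rc$ for some $c\in K^\times$. -/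

import Mathlib

open scoped NumberField

/-- `J` is a full lattice in the finite-dimensional `K`-space `V` with respect to `R`: it is
contained in `R x₁ + ⋯ + R xₙ` for some `K`-basis `x₁, …, xₙ` of `V`, and it spans `V` over `K`
(that is, the canonical map `J ⊗[R] K → V` is onto; it is always injective when `K` is the field
of fractions of `R`). -/
structure IsFullLattice {R V : Type*} (K : Type*) [CommRing R] [Field K] [AddCommGroup V]
    [Module K V] [Module R V] (J : Submodule R V) : Prop where
  exists_basis_le : ∃ x : Module.Basis (Fin (Module.finrank K V)) K V,
    J ≤ Submodule.span R (Set.range x)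
  span_eq_top : Submodule.span K (J : Set V) = ⊤

/-- A principal fractional ideal: an `R`-submodule of `K` of the form `R c` with `c ≠ 0`. -/
def IsPrincipalFractionalIdeal {R K : Type*} [CommRing R] [Field K] [Algebra R K]
    (I : Submodule R K) : Prop :=
  ∃ c : K, c ≠ 0 ∧ I = Submodule.span R {c}

section

variable {R K L : Type*} [CommRing R] [Field K] [Field L] [Algebra R K] [Algebra K L]
  [Algebra R L] [IsScalarTower R K L]

variable (R K L) in
/-- The image of `K` in `L`, as an `R`-submodule of `L`. -/
def baseFieldSubmodule : Submodule R L :=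
  (LinearMap.range (Algebra.linearMap K L)).restrictScalars R

variable (K) in
/-- `J ∩ K`, as an `R`-submodule of `K`. -/
def interBase (J : Submodule R L) : Submodule R K where
  carrier := {k | algebraMap K L k ∈ J}
  zero_mem' := by simp
  add_mem' := fun {a b} ha hb => by
    simpa using J.add_mem ha hb
  smul_mem' := fun r a ha => by
    simpa [Algebra.algebraMap_eq_smul_one] using J.smul_mem r ha

variable (K) in
/-- The coefficient `𝔞 = {k ∈ K : k x₀ ∈ J + K}`, as an `R`-submodule of `K`. -/
def coeffModBase (J : Submodule R L) (x₀ : L) : Submodule R K where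
  carrier := {k | k • x₀ ∈ J ⊔ baseFieldSubmodule R K L}
  zero_mem' := by simp
  add_mem' := fun {a b} ha hb => by
    simpa [add_smul] using Submodule.add_mem _ ha hb
  smul_mem' := fun r a ha => by
    simpa using Submodule.smul_mem _ r ha

end

/-! Let `f : L → K` be the `x₀`-coordinate in the basis `1, x₀`. Its kernel is `K`, so on `J` it has
kernel `J ∩ K` and image `𝔞`. The image is a nonzero finitely generated fractional ideal, hence
projective, and the sequence splits: `J ≅ 𝔞 ⊕ (J ∩ K)`. Steinitz's isomorphism `I ⊕ I' ≅ R ⊕ I I'`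
(`nonempty_linearEquiv_prod_mul`) then gives the first claim: rescale both ideals to be comaximal,
so that addition maps onto `R` with kernel `I ∩ I' = I I'`. For freeness, `J` has rank two, and an
isomorphism `R² ≅ R ⊕ I` makes `I` principal, generated by its determinant
(`exists_eq_span_singleton_of_linearEquiv`). -/

open scoped nonZeroDivisors

section Splitting

variable {R M N : Type*} [CommRing R] [AddCommGroup M] [Module R M] [AddCommGroup N] [Module R N]

/-- A surjection onto a projective module splits off its kernel. -/
theorem nonempty_linearEquiv_prod_ker_of_surjective [Module.Projective R N] (f : M →ₗ[R] N)
    (hf : Function.Surjective f) : Nonempty (M ≃ₗ[R] N × LinearMap.ker f) := by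
  obtain ⟨s, hs⟩ := f.exists_rightInverse_of_surjective (LinearMap.range_eq_top.2 hf)
  exact ⟨(lequivProdOfRightSplitExact (j := (LinearMap.ker f).subtype) (g := f) (f := s)
    (LinearMap.ker f).injective_subtype (Submodule.range_subtype _) hs).symm.trans
    (LinearEquiv.prodComm R _ _)⟩

end Splitting

/-! ### Fractional ideals and Steinitz's isomorphism -/

section FractionField

variable {R K : Type*} [CommRing R] [Field K] [Algebra R K]

/-- Multiplication by a nonzero scalar identifies a submodule with its dilate. -/
theorem nonempty_linearEquiv_span_singleton_mul (I : Submodule R K) {c : K} (hc : c ≠ 0) :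
    Nonempty (I ≃ₗ[R] ↥(Submodule.span R {c} * I)) := by
  have h : I.map (LinearMap.mulLeft R c) = Submodule.span R {c} * I := by
    ext y
    simp [Submodule.mem_span_singleton_mul]
  exact ⟨(Submodule.equivMapOfInjective _ (mul_right_injective₀ hc) I).trans
    (LinearEquiv.ofEq _ _ h)⟩

/-- The unit submodule of an extension with injective structure map is free of rank one. -/
theorem nonempty_linearEquiv_one [FaithfulSMul R K] :
    Nonempty (↥(1 : Submodule R K) ≃ₗ[R] R) := by
  rw [Submodule.one_eq_range]
  exact ⟨(LinearEquiv.ofInjective (Algebra.linearMap R K)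
    (FaithfulSMul.algebraMap_injective R K)).symm⟩

/-- Multiply `I ⊓ J` by `I ⊔ J = 1` and expand; the converse inclusion uses that both submodules lie
in `1`. -/
theorem Submodule.inf_eq_mul_of_sup_eq_one {I J : Submodule R K} (h : I ⊔ J = 1) :
    I ⊓ J = I * J := by
  have hI : I ≤ 1 := h ▸ le_sup_left
  have hJ : J ≤ 1 := h ▸ le_sup_right
  apply le_antisymm
  · calc I ⊓ J = (I ⊓ J) * (I ⊔ J) := by rw [h, mul_one]
      _ = (I ⊓ J) * I ⊔ (I ⊓ J) * J := Submodule.mul_sup _ _ _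
      _ ≤ I * J := by
        refine sup_le ?_ (mul_le_mul' inf_le_left le_rfl)
        rw [mul_comm I J]
        exact mul_le_mul' inf_le_right le_rfl
  · refine le_inf ?_ ?_
    · calc I * J ≤ I * 1 := mul_le_mul' le_rfl hJ
        _ = I := mul_one I
    · calc I * J ≤ 1 * J := mul_le_mul' hI le_rfl
        _ = J := one_mul J

/-- Comaximal submodules satisfy `I ⊕ J ≅ R ⊕ I J`. -/
theorem nonempty_linearEquiv_prod_of_sup_eq_one [FaithfulSMul R K] {I J : Submodule R K}
    (h : I ⊔ J = 1) : Nonempty ((I × J) ≃ₗ[R] R × ↥(I * J)) := by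
  have hI : I ≤ 1 := h ▸ le_sup_left
  have hJ : J ≤ 1 := h ▸ le_sup_right
  obtain ⟨e⟩ := nonempty_linearEquiv_one (R := R) (K := K)
  let f : (I × J) →ₗ[R] ↥(1 : Submodule R K) :=
    (Submodule.inclusion hI).coprod (Submodule.inclusion hJ)
  have hf_coe (p : I × J) : (f p : K) = p.1 + p.2 := by simp [f]
  have hf : Function.Surjective f := by
    rintro ⟨y, hy⟩
    obtain ⟨a, ha, b, hb, rfl⟩ := Submodule.mem_sup.1 (h.symm ▸ hy)
    exact ⟨(⟨a, ha⟩, ⟨b, hb⟩), Subtype.ext (hf_coe _)⟩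
  have : Module.Projective R ↥(1 : Submodule R K) := Module.Projective.of_equiv e.symm
  obtain ⟨g⟩ := nonempty_linearEquiv_prod_ker_of_surjective f hf
  -- The kernel of addition is the antidiagonal copy `y ↦ (y, -y)` of `I ⊓ J`.
  let k : LinearMap.ker f ≃ₗ[R] ↥(I ⊓ J) :=
    { toFun := fun p => ⟨p.1.1, p.1.1.2, by
        have hp : (p.1.1 : K) + p.1.2 = 0 := by
          rw [← hf_coe, LinearMap.mem_ker.1 p.2]; rfl
        rw [eq_neg_of_add_eq_zero_left hp]
        exact J.neg_mem p.1.2.2⟩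
      map_add' := fun _ _ => rfl
      map_smul' := fun _ _ => rfl
      invFun := fun y => ⟨(⟨y, y.2.1⟩, ⟨-y, J.neg_mem y.2.2⟩), by
        rw [LinearMap.mem_ker]
        exact Subtype.ext ((hf_coe _).trans (add_neg_cancel _))⟩
      left_inv := fun p => by
        have hp : (p.1.1 : K) + p.1.2 = 0 := by
          rw [← hf_coe, LinearMap.mem_ker.1 p.2]; rfl
        refine Subtype.ext (Prod.ext rfl (Subtype.ext ?_))
        exact neg_eq_of_add_eq_zero_right hp
      right_inv := fun _ => rfl }
  exact ⟨g.trans (e.prodCongr (k.trans (LinearEquiv.ofEq _ _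
    (Submodule.inf_eq_mul_of_sup_eq_one h))))⟩

/-- If `R ⊕ I` is free of rank two then `I` is generated by the determinant of a basis. -/
theorem exists_eq_span_singleton_of_linearEquiv (I : Submodule R K)
    (e : (R × R) ≃ₗ[R] R × I) : ∃ c : K, I = Submodule.span R {c} := by
  let a := (e (1, 0)).1
  let b := (e (1, 0)).2
  let c := (e (0, 1)).1
  let d := (e (0, 1)).2
  have he (p q : R) : e (p, q) = (p * a + q * c, p • b + q • d) := by
    have : ((p, q) : R × R) = p • (1, 0) + q • (0, 1) := by simp
    rw [this, map_add, map_smul, map_smul]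
    rfl
  refine ⟨((a • d - c • b : I) : K), le_antisymm (fun i hi => ?_) ?_⟩
  · obtain ⟨⟨p, q⟩, hpq⟩ := e.surjective (1, 0)
    obtain ⟨⟨r, s⟩, hrs⟩ := e.surjective (0, ⟨i, hi⟩)
    rw [he, Prod.mk.injEq] at hpq hrs
    obtain ⟨h₁, h₂⟩ := hpq
    obtain ⟨h₃, h₄⟩ := hrs
    have h₁' := congrArg (algebraMap R K) h₁
    have h₂' := congrArg (Subtype.val) h₂
    have h₃' := congrArg (algebraMap R K) h₃
    have h₄' := congrArg (Subtype.val) h₄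
    rw [Submodule.mem_span_singleton]
    -- Multiplicativity of determinants: the preimages `(p, q)`, `(r, s)` of `(1, 0)`, `(0, i)` have
    -- determinant `p s - q r`, and the target pair has determinant `i`.
    refine ⟨p * s - q * r, ?_⟩
    simp only [map_add, map_mul, map_one, map_zero, Submodule.coe_add, Submodule.coe_smul,
      Submodule.coe_sub, Algebra.smul_def, ZeroMemClass.coe_zero, map_sub] at *
    linear_combination (algebraMap R K r * b + algebraMap R K s * d) * h₁' + h₄'
      - (algebraMap R K r * algebraMap R K a + algebraMap R K s * algebraMap R K c) * h₂'
  · rw [Submodule.span_singleton_le_iff_mem]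
    exact Subtype.property _

variable [IsDedekindDomain R] [IsFractionRing R K]

open FractionalIdeal in
/-- Two nonzero fractional ideals have comaximal integral dilates. -/
theorem FractionalIdeal.exists_spanSingleton_mul_add_eq_one {I J : FractionalIdeal R⁰ K}
    (hI : I ≠ 0) (hJ : J ≠ 0) : ∃ u v : K, u ≠ 0 ∧ v ≠ 0 ∧
      spanSingleton R⁰ u * I + spanSingleton R⁰ v * J = 1 := by
  obtain ⟨d, C, hd, hC⟩ := exists_eq_spanSingleton_mul I⁻¹
  obtain ⟨b, B, hb, hB⟩ := exists_eq_spanSingleton_mul J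
  have hd' : algebraMap R K d ≠ 0 := by simpa using hd
  have hb' : algebraMap R K b ≠ 0 := by simpa using hb
  have hC0 : C ≠ ⊥ := by
    rintro rfl
    exact inv_ne_zero hI (by simpa using hC)
  have hB0 : B ≠ ⊥ := by
    rintro rfl
    exact hJ (by simpa using hB)
  have hCB : C * B ≠ ⊥ := mul_ne_zero hC0 hB0
  -- Dividing `C B + (x) = C` by `C`, a multiple of `I⁻¹`, yields `B + x C⁻¹ = 1`, with `C⁻¹` a
  -- multiple of `I`. A nonzero `x` is needed for `u ≠ 0`; if `x = 0` works, so does any element of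
  -- `C`.
  obtain ⟨x, hx0, hx⟩ : ∃ x, x ≠ 0 ∧ C * B ⊔ Ideal.span {x} = C := by
    obtain ⟨x, hx⟩ := IsDedekindDomain.exists_sup_span_eq (Ideal.mul_le_left : C * B ≤ C) hCB
    rcases eq_or_ne x 0 with rfl | h
    · obtain ⟨y, hy, hy0⟩ := Submodule.exists_mem_ne_zero_of_ne_bot hC0
      have hCB' : C * B = C := by simpa using hx
      exact ⟨y, hy0, by rw [hCB', sup_eq_left]; simpa using hy⟩
    · exact ⟨x, h, hx⟩
  have hx0' : algebraMap R K x ≠ 0 := by simpa using hx0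
  have hC' : (C : FractionalIdeal R⁰ K) ≠ 0 := by simpa using hC0
  have hx' := congrArg (fun A : Ideal R => (A : FractionalIdeal R⁰ K)) hx
  simp only [coeIdeal_sup, coeIdeal_mul, coeIdeal_span_singleton] at hx'
  have hIC : spanSingleton R⁰ (algebraMap R K d)⁻¹ * I = (C : FractionalIdeal R⁰ K)⁻¹ := by
    rw [← inv_inv I, hC, mul_inv, ← mul_assoc, spanSingleton_inv, inv_inv,
      spanSingleton_mul_spanSingleton, inv_mul_cancel₀ hd', spanSingleton_one, one_mul]
  have hBJ : spanSingleton R⁰ (algebraMap R K b) * J = B := by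
    rw [hB, ← mul_assoc, spanSingleton_mul_spanSingleton, mul_inv_cancel₀ hb', spanSingleton_one,
      one_mul]
  refine ⟨algebraMap R K x * (algebraMap R K d)⁻¹, algebraMap R K b,
    mul_ne_zero hx0' (inv_ne_zero hd'), hb', ?_⟩
  rw [← spanSingleton_mul_spanSingleton, mul_assoc, hIC, hBJ]
  calc _ = (C * B + spanSingleton R⁰ (algebraMap R K x)) * (C : FractionalIdeal R⁰ K)⁻¹ := by
        rw [add_mul, mul_right_comm, mul_inv_cancel₀ hC', one_mul, add_comm]
    _ = 1 := by rw [hx', mul_inv_cancel₀ hC']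

/-- **Steinitz**: nonzero finitely generated submodules `I`, `J` of the fraction field of a
Dedekind domain satisfy `I ⊕ J ≅ R ⊕ I J`. -/
theorem nonempty_linearEquiv_prod_mul {I J : Submodule R K} (hI : I ≠ ⊥) (hJ : J ≠ ⊥)
    (hIfg : I.FG) (hJfg : J.FG) : Nonempty ((I × J) ≃ₗ[R] R × ↥(I * J)) := by
  let I' : FractionalIdeal R⁰ K := ⟨I, FractionalIdeal.isFractional_of_fg hIfg⟩
  let J' : FractionalIdeal R⁰ K := ⟨J, FractionalIdeal.isFractional_of_fg hJfg⟩
  have hI' : I' ≠ 0 := fun h => hI (by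
    simpa [I'] using congrArg (fun A : FractionalIdeal R⁰ K => (A : Submodule R K)) h)
  have hJ' : J' ≠ 0 := fun h => hJ (by
    simpa [J'] using congrArg (fun A : FractionalIdeal R⁰ K => (A : Submodule R K)) h)
  obtain ⟨u, v, hu, hv, h⟩ := FractionalIdeal.exists_spanSingleton_mul_add_eq_one hI' hJ'
  have h' : Submodule.span R {u} * I ⊔ Submodule.span R {v} * J = 1 := by
    have := congrArg (fun A : FractionalIdeal R⁰ K => (A : Submodule R K)) h
    simp only [FractionalIdeal.coe_add, FractionalIdeal.coe_mul, FractionalIdeal.coe_one,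
      FractionalIdeal.coe_spanSingleton, Submodule.add_eq_sup] at this
    exact this
  obtain ⟨e⟩ := nonempty_linearEquiv_prod_of_sup_eq_one h'
  obtain ⟨eI⟩ := nonempty_linearEquiv_span_singleton_mul I hu
  obtain ⟨eJ⟩ := nonempty_linearEquiv_span_singleton_mul J hv
  obtain ⟨eIJ⟩ := nonempty_linearEquiv_span_singleton_mul (I * J) (mul_ne_zero hu hv)
  have hmul : Submodule.span R {u} * I * (Submodule.span R {v} * J) =
      Submodule.span R {u * v} * (I * J) := by
    rw [mul_mul_mul_comm, Submodule.span_mul_span, Set.singleton_mul_singleton]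
  exact ⟨(eI.prodCongr eJ).trans (e.trans ((LinearEquiv.refl R R).prodCongr
    ((LinearEquiv.ofEq _ _ hmul).trans eIJ.symm)))⟩

/-- Nonzero fractional ideals of a Dedekind domain are invertible, hence projective. -/
theorem Submodule.FG.projective_of_ne_bot {I : Submodule R K} (hI : I ≠ ⊥) (hfg : I.FG) :
    Module.Projective R I := by
  let I' : FractionalIdeal R⁰ K := ⟨I, FractionalIdeal.isFractional_of_fg hfg⟩
  have hI' : I' ≠ 0 := fun h => hI (by
    simpa [I'] using congrArg (fun A : FractionalIdeal R⁰ K => (A : Submodule R K)) h)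
  exact Submodule.projective_of_isUnit
    ((isUnit_iff_ne_zero.2 hI').map (FractionalIdeal.coeSubmoduleHom R⁰ K))

end FractionField

/-! ### Full lattices: finiteness and rank -/

section Lattice

variable {R K V : Type*} [CommRing R] [Field K] [AddCommGroup V] [Module K V] [Module R V]

theorem IsFullLattice.fg [IsNoetherianRing R] {J : Submodule R V} (hJ : IsFullLattice K J) :
    J.FG := by
  obtain ⟨x, hx⟩ := hJ.exists_basis_le
  have := isNoetherian_span_of_finite R (Set.finite_range x)
  have := isNoetherian_of_le hx
  exact (Module.Finite.iff_fg).1 inferInstance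

variable [Algebra R K] [IsScalarTower R K V] [IsFractionRing R K]

/-- Every vector has a nonzero multiple in a given full lattice. -/
theorem IsFullLattice.exists_smul_mem [IsDomain R] {J : Submodule R V}
    (hJ : IsFullLattice K J) (y : V) :
    ∃ r : R, r ≠ 0 ∧ r • y ∈ J := by
  have hy : y ∈ Submodule.span K (J : Set V) := hJ.span_eq_top ▸ Submodule.mem_top
  induction hy using Submodule.span_induction with
  | mem y hy => exact ⟨1, one_ne_zero, by simpa using hy⟩
  | zero => exact ⟨1, one_ne_zero, by simp⟩
  | add y z _ _ hy hz =>
    obtain ⟨r, hr, hy⟩ := hy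
    obtain ⟨s, hs, hz⟩ := hz
    refine ⟨r * s, mul_ne_zero hr hs, ?_⟩
    rw [smul_add, mul_smul r s z, mul_comm, mul_smul]
    exact J.add_mem (J.smul_mem _ hy) (J.smul_mem _ hz)
  | smul k y _ hy =>
    obtain ⟨r, hr, hy⟩ := hy
    obtain ⟨n, d, hd, rfl⟩ := IsFractionRing.div_surjective (A := R) k
    have hd0 : d ≠ 0 := nonZeroDivisors.ne_zero hd
    have hd' : algebraMap R K d ≠ 0 := by simpa using hd0
    refine ⟨d * r, mul_ne_zero hd0 hr, ?_⟩
    have : (d * r) • (algebraMap R K n / algebraMap R K d) • y = n • r • y := by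
      simp only [← algebraMap_smul K (_ : R) (_ : V), smul_smul, map_mul]
      congr 1
      field_simp
    rw [this]
    exact J.smul_mem _ hy

/-- A basis of a full lattice has as many elements as the dimension of the ambient space. -/
theorem IsFullLattice.card_basis {J : Submodule R V} (hJ : IsFullLattice K J) {ι : Type*}
    [Fintype ι] (b : Module.Basis ι R J) : Fintype.card ι = Module.finrank K V := by
  have hli : LinearIndependent K (fun i => (b i : V)) := by
    rw [← LinearIndependent.iff_fractionRing (R := R)]
    exact b.linearIndependent.map' J.subtype J.ker_subtype
  refine (Module.finrank_eq_card_basis (Module.Basis.mk hli ?_)).symm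
  rw [← hJ.span_eq_top, Submodule.span_le]
  intro y hy
  have : y ∈ Submodule.span R (Set.range fun i => (b i : V)) := by
    have h := congrArg (Submodule.map J.subtype) b.span_eq
    rw [Submodule.map_span, ← Set.range_comp, Submodule.map_subtype_top] at h
    exact h.symm ▸ hy
  exact Submodule.span_le_restrictScalars R K _ this

end Lattice

/-! ### Lattices in quadratic extensions -/

section Quadratic

variable {R K L : Type*} [CommRing R] [Field K] [Field L] [Algebra R K] [Algebra K L]
  [Algebra R L] [IsScalarTower R K L]

/-- In a quadratic extension, the coordinate along `x₀ ∉ K` in the basis `1, x₀`. -/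
theorem exists_linearMap_eq_zero_iff_mem_range [Algebra.IsQuadraticExtension K L] {x₀ : L}
    (hx₀ : x₀ ∉ Set.range (algebraMap K L)) :
    ∃ f : L →ₗ[K] K, f x₀ = 1 ∧ ∀ y, f y = 0 ↔ y ∈ Set.range (algebraMap K L) := by
  have hli : LinearIndependent K ![(1 : L), x₀] := by
    rw [LinearIndependent.pair_iff' one_ne_zero]
    intro a ha
    exact hx₀ ⟨a, by rw [← ha, Algebra.algebraMap_eq_smul_one]⟩
  let b := basisOfLinearIndependentOfCardEqFinrank hli
    (by simp [Algebra.IsQuadraticExtension.finrank_eq_two K L])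
  have hb0 : b 0 = 1 := by simp [b]
  have hb1 : b 1 = x₀ := by simp [b]
  refine ⟨b.coord 1, ?_, fun y => ⟨fun hy => ?_, ?_⟩⟩
  · rw [← hb1]; simp
  · refine ⟨b.repr y 0, ?_⟩
    have h := b.sum_repr y
    rw [Fin.sum_univ_two, hb0] at h
    rw [Algebra.algebraMap_eq_smul_one]
    rw [Module.Basis.coord_apply] at hy
    simpa [hy] using h
  · rintro ⟨k, rfl⟩
    rw [Algebra.algebraMap_eq_smul_one, ← hb0]
    simp

/-- Each `y` is congruent to `f y • x₀` modulo `K`, since `f` kills the difference. This form of `𝔞`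
makes it finitely generated. -/
theorem coeffModBase_eq_map {x₀ : L} {f : L →ₗ[K] K} (hf₀ : f x₀ = 1)
    (hf : ∀ y, f y = 0 ↔ y ∈ Set.range (algebraMap K L)) (J : Submodule R L) :
    coeffModBase K J x₀ = J.map (f.restrictScalars R) := by
  ext k
  change k • x₀ ∈ J ⊔ baseFieldSubmodule R K L ↔ _
  rw [Submodule.mem_sup, Submodule.mem_map]
  constructor
  · rintro ⟨j, hj, z, ⟨a, rfl⟩, h⟩
    refine ⟨j, hj, ?_⟩
    have h' := congrArg f h
    have ha : f (algebraMap K L a) = 0 := (hf _).2 ⟨a, rfl⟩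
    simpa [ha, hf₀] using h'
  · rintro ⟨j, hj, rfl⟩
    obtain ⟨a, ha⟩ := (hf (f j • x₀ - j)).1 (by simp [hf₀])
    exact ⟨j, hj, algebraMap K L a, ⟨a, rfl⟩, by rw [ha]; simp⟩

section IsDomain

variable [IsDomain R] [IsFractionRing R K]

theorem IsFullLattice.interBase_ne_bot {J : Submodule R L} (hJ : IsFullLattice K J) :
    interBase K J ≠ ⊥ := by
  obtain ⟨r, hr, h⟩ := hJ.exists_smul_mem (1 : L)
  have hmem : algebraMap R K r ∈ interBase K J := by
    change algebraMap K L (algebraMap R K r) ∈ J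
    rwa [← IsScalarTower.algebraMap_apply, Algebra.algebraMap_eq_smul_one]
  intro hbot
  rw [hbot, Submodule.mem_bot] at hmem
  exact hr (by simpa using hmem)

theorem IsFullLattice.coeffModBase_ne_bot {J : Submodule R L} (hJ : IsFullLattice K J)
    (x₀ : L) : coeffModBase K J x₀ ≠ ⊥ := by
  obtain ⟨r, hr, h⟩ := hJ.exists_smul_mem x₀
  have hmem : algebraMap R K r ∈ coeffModBase K J x₀ := by
    change algebraMap R K r • x₀ ∈ J ⊔ baseFieldSubmodule R K L
    rw [algebraMap_smul]
    exact Submodule.mem_sup_left h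
  intro hbot
  rw [hbot, Submodule.mem_bot] at hmem
  exact hr (by simpa using hmem)

end IsDomain

theorem IsFullLattice.interBase_fg [IsNoetherianRing R] {J : Submodule R L} (hJ : IsFullLattice K J) :
    (interBase K J).FG := by
  have := isNoetherian_of_fg_of_noetherian J hJ.fg
  let g : interBase K J →ₗ[R] J :=
    ((Algebra.linearMap K L).restrictScalars R).restrict (fun _ h => h)
  have hg : Function.Injective g := fun a b h =>
    Subtype.ext ((algebraMap K L).injective (congrArg Subtype.val h))
  have := isNoetherian_of_injective g hg
  exact (Module.Finite.iff_fg).1 inferInstance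

variable [IsDedekindDomain R] [IsFractionRing R K] [Algebra.IsQuadraticExtension K L]

/-- A full lattice in a quadratic extension splits as `J ≅ 𝔞 ⊕ (J ∩ K)`. -/
theorem IsFullLattice.nonempty_linearEquiv_prod {J : Submodule R L} (hJ : IsFullLattice K J)
    {x₀ : L} (hx₀ : x₀ ∉ Set.range (algebraMap K L)) :
    (coeffModBase K J x₀).FG ∧
      Nonempty (J ≃ₗ[R] coeffModBase K J x₀ × interBase K J) := by
  obtain ⟨f, hf₀, hf⟩ := exists_linearMap_eq_zero_iff_mem_range hx₀
  have hne := hJ.coeffModBase_ne_bot x₀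
  rw [coeffModBase_eq_map hf₀ hf] at hne ⊢
  have hfg := hJ.fg.map (f.restrictScalars R)
  have := hfg.projective_of_ne_bot hne
  let g := (f.restrictScalars R).submoduleMap J
  obtain ⟨e⟩ := nonempty_linearEquiv_prod_ker_of_surjective g
    (LinearMap.submoduleMap_surjective _ _)
  let h : interBase K J →ₗ[R] LinearMap.ker g :=
    LinearMap.codRestrict _
      (((Algebra.linearMap K L).restrictScalars R).restrict (fun _ h => h)) (fun a => by
        rw [LinearMap.mem_ker]
        exact Subtype.ext ((hf _).2 ⟨a, rfl⟩))
  have hbij : Function.Bijective h := by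
    constructor
    · intro a b hab
      exact Subtype.ext ((algebraMap K L).injective
        (congrArg (fun z : LinearMap.ker g => (z.1.1 : L)) hab))
    · rintro ⟨⟨y, hy⟩, hker⟩
      obtain ⟨a, rfl⟩ := (hf y).1 (congrArg Subtype.val (LinearMap.mem_ker.1 hker))
      exact ⟨⟨a, hy⟩, rfl⟩
  exact ⟨hfg, ⟨e.trans ((LinearEquiv.refl R _).prodCongr (LinearEquiv.ofBijective h hbij).symm)⟩⟩

/-- The Steinitz form `J ≅ R ⊕ 𝔞 (J ∩ K)` of a full lattice in a quadratic extension. -/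
theorem IsFullLattice.nonempty_linearEquiv_prod_mul {J : Submodule R L} (hJ : IsFullLattice K J)
    {x₀ : L} (hx₀ : x₀ ∉ Set.range (algebraMap K L)) :
    Nonempty (J ≃ₗ[R] R × ↥(coeffModBase K J x₀ * interBase K J)) := by
  obtain ⟨hfg, ⟨e⟩⟩ := hJ.nonempty_linearEquiv_prod hx₀
  obtain ⟨e'⟩ := _root_.nonempty_linearEquiv_prod_mul
    (hJ.coeffModBase_ne_bot x₀)
    hJ.interBase_ne_bot hfg hJ.interBase_fg
  exact ⟨e.trans e'⟩

theorem IsFullLattice.free_iff {J : Submodule R L} (hJ : IsFullLattice K J)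
    {x₀ : L} (hx₀ : x₀ ∉ Set.range (algebraMap K L)) :
    Module.Free R J ↔ IsPrincipalFractionalIdeal (coeffModBase K J x₀ * interBase K J) := by
  obtain ⟨e⟩ := hJ.nonempty_linearEquiv_prod_mul hx₀
  constructor
  · intro hfree
    have : Module.Finite R J := Module.Finite.iff_fg.2 hJ.fg
    let b := Module.Free.chooseBasis R J
    have hcard : Fintype.card (Module.Free.ChooseBasisIndex R J) = Fintype.card (Fin 2) := by
      rw [hJ.card_basis b, Algebra.IsQuadraticExtension.finrank_eq_two, Fintype.card_fin]
    let b' := b.reindex (Fintype.equivOfCardEq hcard)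
    obtain ⟨c, hc⟩ := exists_eq_span_singleton_of_linearEquiv _
      ((LinearEquiv.finTwoArrow R R).symm.trans (b'.equivFun.symm.trans e))
    refine ⟨c, ?_, hc⟩
    rintro rfl
    -- The generator is nonzero because a product of nonzero submodules of `K` is nonzero.
    rw [Submodule.span_zero_singleton, ← Submodule.zero_eq_bot, mul_eq_zero] at hc
    exact hc.elim (hJ.coeffModBase_ne_bot x₀)
      hJ.interBase_ne_bot
  · rintro ⟨c, hc, h⟩
    rw [h] at e
    exact Module.Free.of_equiv (e.trans ((LinearEquiv.refl R R).prodCongr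
      (LinearEquiv.toSpanNonzeroSingleton R K c hc).symm)).symm

end Quadratic

theorem corollary27 (K L : Type*) [Field K] [NumberField K] [Field L] [Algebra K L]
    [Algebra.IsQuadraticExtension K L]
    (J : Submodule (𝓞 K) L) (hJ : IsFullLattice K J)
    (x₀ : L) (hx₀ : x₀ ∉ Set.range (algebraMap K L)) :
    Nonempty (J ≃ₗ[𝓞 K] 𝓞 K × ↥(coeffModBase K J x₀ * interBase K J)) ∧
    (Module.Free (𝓞 K) J ↔
      IsPrincipalFractionalIdeal (coeffModBase K J x₀ * interBase K J)) :=
  ⟨hJ.nonempty_linearEquiv_prod_mul hx₀, hJ.free_iff hx₀⟩
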